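/- Let $\Bbbk$ be a countable (i.e., at most countable) totally ordered division ring. A lattice $L$ with a least element $0$ is \emph{completely normal} if for all $a,b\in L$ there are $x,y\in L$ with $a\le x\vee b$, $b\le a\vee y$ and $x\wedge y=0$. A \emph{vector lattice} over $\Bbbk$ is a left $\Bbbk$-vector space $F$ with a lattice order that is invariant under translations and under multiplication by nonnegative scalars. An \emph{$\ell$-ideal} of $F$ is an order-convex $\Bbbk$-linear subspace closed under the lattice operations. The \emph{principal} $\ell$-ideal generated by $a\in F$ is $\langle a\rangle=\{x\in F : |x|\le c\,|a|\text{ for some }c\in\Bbbk,\ c\ge 0\}$, and $\operatorname{Id}_c F=\{\langle a\rangle : a\in F\}$, ordered by inclusion, is a lattice with least element $\langle 0\rangle$. Then for every completely normal distributive lattice $L$ with a least element and with at most $\aleph_1$ elements, there are a vector lattice $F$ over $\Bbbk$ and a surjective lattice homomorphism $\operatorname{Id}_c F\to L$ (which necessarily sends the least element to the least element). -/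

import Mathlib

open scoped Cardinal

universe u v

set_option linter.unusedSectionVars false

/-! ### Completely normal lattices -/

/-- Two elements `a`, `b` of a lattice with bottom element `⊥` are *consonant* if there are
`x`, `y` with `a ≤ x ⊔ b`, `b ≤ a ⊔ y` and `x ⊓ y = ⊥`. -/
def Consonant {D : Type*} [Lattice D] [OrderBot D] (a b : D) : Prop :=
  ∃ x y : D, a ≤ x ⊔ b ∧ b ≤ a ⊔ y ∧ x ⊓ y = ⊥

/-- A lattice with bottom element is *completely normal* if any two elements are consonant. -/
def CompletelyNormalLattice (D : Type*) [Lattice D] [OrderBot D] : Prop :=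
  ∀ a b : D, Consonant a b

/-! ### ℓ-ideals of vector lattices

A (left) vector lattice over a totally ordered division ring `𝕜` is a left `𝕜`-vector space `F`
with a lattice order which is invariant under translations (`IsOrderedAddMonoid F`) and compatible
with multiplication by nonnegative scalars (`IsOrderedModule 𝕜 F`). -/

/-- An *ℓ-ideal* of a vector lattice: a linear subspace that is order-convex and closed under the
lattice operations. -/
structure LIdeal (𝕜 F : Type*) [DivisionRing 𝕜] [AddCommGroup F] [Lattice F] [Module 𝕜 F]
    extends Submodule 𝕜 F where
  convex' : ∀ ⦃a b x : F⦄, a ∈ carrier → b ∈ carrier → a ≤ x → x ≤ b → x ∈ carrier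
  sup_mem' : ∀ ⦃a b : F⦄, a ∈ carrier → b ∈ carrier → a ⊔ b ∈ carrier
  inf_mem' : ∀ ⦃a b : F⦄, a ∈ carrier → b ∈ carrier → a ⊓ b ∈ carrier

namespace LIdeal

section Order

variable {𝕜 F : Type*} [DivisionRing 𝕜] [AddCommGroup F] [Lattice F] [Module 𝕜 F]

instance : SetLike (LIdeal 𝕜 F) F where
  coe I := I.carrier
  coe_injective I J h := by
    obtain ⟨I', _, _, _⟩ := I
    obtain ⟨J', _, _, _⟩ := J
    have : I' = J' := SetLike.coe_injective h
    subst this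
    rfl

/-- ℓ-ideals are ordered by inclusion. -/
instance : PartialOrder (LIdeal 𝕜 F) := PartialOrder.ofSetLike (LIdeal 𝕜 F) F

theorem le_iff {I J : LIdeal 𝕜 F} : I ≤ J ↔ ∀ x ∈ I, x ∈ J := Iff.rfl

end Order

variable {𝕜 F : Type*} [DivisionRing 𝕜] [LinearOrder 𝕜] [IsStrictOrderedRing 𝕜]
  [AddCommGroup F] [Lattice F] [IsOrderedAddMonoid F] [Module 𝕜 F] [IsOrderedModule 𝕜 F]

theorem abs_smul_le_abs_smul_abs (c : 𝕜) (x : F) : |c • x| ≤ |c| • |x| := by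
  rcases le_total 0 c with hc | hc
  · rw [abs_of_nonneg hc]
    refine abs_le'.2 ⟨smul_le_smul_of_nonneg_left (le_abs_self x) hc, ?_⟩
    rw [← smul_neg]
    exact smul_le_smul_of_nonneg_left (neg_le_abs x) hc
  · rw [abs_of_nonpos hc]
    have hc' : 0 ≤ -c := neg_nonneg.2 hc
    refine abs_le'.2 ⟨?_, ?_⟩
    · rw [← neg_smul_neg]
      exact smul_le_smul_of_nonneg_left (neg_le_abs x) hc'
    · rw [← neg_smul]
      exact smul_le_smul_of_nonneg_left (le_abs_self x) hc'

theorem sup_mem_of_abs_le {a b x y : F} (hx : |x| ≤ a) (hy : |y| ≤ b) :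
    |x ⊔ y| ≤ a + b ∧ |x ⊓ y| ≤ a + b := by
  have ha : 0 ≤ a := (abs_nonneg x).trans hx
  have hb : 0 ≤ b := (abs_nonneg y).trans hy
  have h1 := (abs_le'.1 hx)
  have h2 := (abs_le'.1 hy)
  have hab : a ≤ a + b := le_add_of_nonneg_right hb
  have hba : b ≤ a + b := le_add_of_nonneg_left ha
  refine ⟨abs_le'.2 ⟨sup_le (h1.1.trans hab) (h2.1.trans hba), ?_⟩,
    abs_le'.2 ⟨inf_le_left.trans (h1.1.trans hab), ?_⟩⟩
  · rw [neg_sup]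
    exact inf_le_left.trans (h1.2.trans hab)
  · rw [neg_inf]
    exact sup_le (h1.2.trans hab) (h2.2.trans hba)

variable (𝕜) in
/-- The principal ℓ-ideal `⟨a⟩ = {x | |x| ≤ c • |a| for some scalar c ≥ 0}`. It is the least
ℓ-ideal containing `a`, see `LIdeal.principal_le_iff`. -/
def principal (a : F) : LIdeal 𝕜 F where
  carrier := {x | ∃ c : 𝕜, 0 ≤ c ∧ |x| ≤ c • |a|}
  zero_mem' := ⟨0, le_rfl, by simp⟩
  add_mem' := by
    rintro x y ⟨c, hc, hx⟩ ⟨d, hd, hy⟩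
    refine ⟨c + d, add_nonneg hc hd, (abs_add_le x y).trans ?_⟩
    rw [add_smul]
    exact add_le_add hx hy
  smul_mem' := by
    rintro d x ⟨c, hc, hx⟩
    refine ⟨|d| * c, mul_nonneg (abs_nonneg d) hc, (abs_smul_le_abs_smul_abs d x).trans ?_⟩
    rw [mul_smul]
    exact smul_le_smul_of_nonneg_left hx (abs_nonneg d)
  convex' := by
    rintro x y z ⟨c, hc, hx⟩ ⟨d, hd, hy⟩ hxz hzy
    refine ⟨c + d, add_nonneg hc hd, ?_⟩
    rw [add_smul]
    refine abs_le'.2 ⟨?_, ?_⟩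
    · exact (hzy.trans (le_abs_self y)).trans
        (hy.trans (le_add_of_nonneg_left ((abs_nonneg x).trans hx)))
    · exact ((neg_le_neg hxz).trans (neg_le_abs x)).trans
        (hx.trans (le_add_of_nonneg_right ((abs_nonneg y).trans hy)))
  sup_mem' := by
    rintro x y ⟨c, hc, hx⟩ ⟨d, hd, hy⟩
    refine ⟨c + d, add_nonneg hc hd, ?_⟩
    rw [add_smul]
    exact (sup_mem_of_abs_le hx hy).1
  inf_mem' := by
    rintro x y ⟨c, hc, hx⟩ ⟨d, hd, hy⟩
    refine ⟨c + d, add_nonneg hc hd, ?_⟩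
    rw [add_smul]
    exact (sup_mem_of_abs_le hx hy).2

theorem mem_principal {a x : F} : x ∈ principal 𝕜 a ↔ ∃ c : 𝕜, 0 ≤ c ∧ |x| ≤ c • |a| := Iff.rfl

theorem abs_mem {I : LIdeal 𝕜 F} {x : F} (hx : x ∈ I) : |x| ∈ I :=
  I.sup_mem' hx (I.toSubmodule.neg_mem hx)

theorem mem_of_abs_le {I : LIdeal 𝕜 F} {x y : F} (hy : y ∈ I) (h : |x| ≤ y) : x ∈ I :=
  I.convex' (I.toSubmodule.neg_mem hy) hy (neg_le.1 ((neg_le_abs x).trans h))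
    ((le_abs_self x).trans h)

/-- `⟨a⟩` is the least ℓ-ideal containing `a`. -/
theorem principal_le_iff {a : F} {I : LIdeal 𝕜 F} : principal 𝕜 a ≤ I ↔ a ∈ I := by
  refine ⟨fun h => le_iff.1 h a ⟨1, zero_le_one, by simp⟩, fun h => le_iff.2 ?_⟩
  rintro x ⟨c, -, hx⟩
  exact mem_of_abs_le (I.toSubmodule.smul_mem c (abs_mem h)) hx

theorem principal_le_principal {a b : F} (h : |a| ≤ |b|) : principal 𝕜 a ≤ principal 𝕜 b :=
  principal_le_iff.2 ⟨1, zero_le_one, by simpa using h⟩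

end LIdeal

/-- `Idc 𝕜 F` is the set of all principal ℓ-ideals of the `𝕜`-vector lattice `F`,
ordered by inclusion. -/
def Idc (𝕜 F : Type*) [DivisionRing 𝕜] [LinearOrder 𝕜] [IsStrictOrderedRing 𝕜]
    [AddCommGroup F] [Lattice F] [IsOrderedAddMonoid F] [Module 𝕜 F] [IsOrderedModule 𝕜 F] :
    Type _ :=
  {I : LIdeal 𝕜 F // ∃ a : F, I = LIdeal.principal 𝕜 a}

namespace Idc

variable {𝕜 F : Type*} [DivisionRing 𝕜] [LinearOrder 𝕜] [IsStrictOrderedRing 𝕜]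
  [AddCommGroup F] [Lattice F] [IsOrderedAddMonoid F] [Module 𝕜 F] [IsOrderedModule 𝕜 F]

instance : PartialOrder (Idc 𝕜 F) :=
  inferInstanceAs (PartialOrder {I : LIdeal 𝕜 F // ∃ a : F, I = LIdeal.principal 𝕜 a})

variable (𝕜) in
/-- The element `⟨a⟩` of `Idc 𝕜 F`. -/
def mk (a : F) : Idc 𝕜 F := ⟨LIdeal.principal 𝕜 a, a, rfl⟩

/-- A generator of a principal ℓ-ideal. -/
noncomputable def gen (I : Idc 𝕜 F) : F := I.2.choose

theorem mk_gen (I : Idc 𝕜 F) : mk 𝕜 I.gen = I := Subtype.ext I.2.choose_spec.symm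

theorem mk_le_mk {a b : F} : mk 𝕜 a ≤ mk 𝕜 b ↔ a ∈ LIdeal.principal 𝕜 b :=
  LIdeal.principal_le_iff

theorem isLUB_mk (a b : F) : IsLUB {mk 𝕜 a, mk 𝕜 b} (mk 𝕜 (|a| ⊔ |b|)) := by
  have h : |(|a| ⊔ |b|)| = |a| ⊔ |b| := abs_of_nonneg (le_sup_of_le_left (abs_nonneg a))
  constructor
  · rintro I (rfl | rfl)
    · exact LIdeal.principal_le_principal (le_sup_left.trans_eq h.symm)
    · exact LIdeal.principal_le_principal (le_sup_right.trans_eq h.symm)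
  · intro I hI
    have ha : a ∈ I.1 := LIdeal.principal_le_iff.1 (hI (Set.mem_insert _ _))
    have hb : b ∈ I.1 := LIdeal.principal_le_iff.1 (hI (Set.mem_insert_of_mem _ rfl))
    exact LIdeal.principal_le_iff.2 (I.1.sup_mem' (LIdeal.abs_mem ha) (LIdeal.abs_mem hb))

theorem isGLB_mk (a b : F) : IsGLB {mk 𝕜 a, mk 𝕜 b} (mk 𝕜 (|a| ⊓ |b|)) := by
  have h : |(|a| ⊓ |b|)| = |a| ⊓ |b| := abs_of_nonneg (le_inf (abs_nonneg a) (abs_nonneg b))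
  constructor
  · rintro I (rfl | rfl)
    · exact LIdeal.principal_le_principal (h.trans_le inf_le_left)
    · exact LIdeal.principal_le_principal (h.trans_le inf_le_right)
  · intro I hI
    refine LIdeal.le_iff.2 fun x hx => ?_
    obtain ⟨c, hc, hxa⟩ := LIdeal.le_iff.1 (hI (Set.mem_insert _ _)) x hx
    obtain ⟨d, hd, hxb⟩ := LIdeal.le_iff.1 (hI (Set.mem_insert_of_mem _ rfl)) x hx
    have he : 0 < c + d + 1 := add_pos_of_nonneg_of_pos (add_nonneg hc hd) zero_lt_one
    have key : ∀ {r : 𝕜} {y : F}, r ≤ c + d + 1 → |x| ≤ r • |y| →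
        (c + d + 1)⁻¹ • |x| ≤ |y| := by
      intro r y hr hy
      have h1 : |x| ≤ (c + d + 1) • |y| :=
        hy.trans (smul_le_smul_of_nonneg_right hr (abs_nonneg y))
      have h2 := smul_le_smul_of_nonneg_left h1 (inv_nonneg.2 he.le)
      rwa [inv_smul_smul₀ he.ne'] at h2
    have hc' : c ≤ c + d + 1 :=
      (le_add_of_nonneg_right hd).trans (le_add_of_nonneg_right zero_le_one)
    have hd' : d ≤ c + d + 1 :=
      (le_add_of_nonneg_left hc).trans (le_add_of_nonneg_right zero_le_one)
    have h3 := smul_le_smul_of_nonneg_left (le_inf (key hc' hxa) (key hd' hxb)) he.le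
    rw [smul_inv_smul₀ he.ne'] at h3
    exact ⟨c + d + 1, he.le, by rwa [h]⟩

/-- The lattice structure of `Idc 𝕜 F` for the inclusion order, with
`⟨a⟩ ⊔ ⟨b⟩ = ⟨|a| ⊔ |b|⟩` and `⟨a⟩ ⊓ ⟨b⟩ = ⟨|a| ⊓ |b|⟩`. -/
noncomputable instance : Lattice (Idc 𝕜 F) where
  sup I J := mk 𝕜 (|I.gen| ⊔ |J.gen|)
  inf I J := mk 𝕜 (|I.gen| ⊓ |J.gen|)
  le_sup_left I J := by
    simpa only [mk_gen] using (isLUB_mk (𝕜 := 𝕜) I.gen J.gen).1 (Set.mem_insert _ _)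
  le_sup_right I J := by
    simpa only [mk_gen] using (isLUB_mk (𝕜 := 𝕜) I.gen J.gen).1 (Set.mem_insert_of_mem _ rfl)
  sup_le I J K hI hJ := by
    refine (isLUB_mk (𝕜 := 𝕜) I.gen J.gen).2 ?_
    rintro _ (rfl | rfl) <;> simpa only [mk_gen]
  inf_le_left I J := by
    simpa only [mk_gen] using (isGLB_mk (𝕜 := 𝕜) I.gen J.gen).1 (Set.mem_insert _ _)
  inf_le_right I J := by
    simpa only [mk_gen] using (isGLB_mk (𝕜 := 𝕜) I.gen J.gen).1 (Set.mem_insert_of_mem _ rfl)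
  le_inf K I J hI hJ := by
    refine (isGLB_mk (𝕜 := 𝕜) I.gen J.gen).2 ?_
    rintro _ (rfl | rfl) <;> simpa only [mk_gen]

/-- The bottom element of `Idc 𝕜 F` is `⟨0⟩`. -/
instance : OrderBot (Idc 𝕜 F) where
  bot := mk 𝕜 0
  bot_le I := LIdeal.principal_le_iff.2 I.1.toSubmodule.zero_mem

end Idc

/-! ### Prime ideals of distributive lattices -/

section Prime

variable {L : Type*} [DistribLattice L]

/-! Read elements of `L` as truth values, a prime ideal `P` being a valuation under which its
members are false. The core is a map `a` from the free space `L →₀ 𝕜` to `L` that behaves like the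
truth value of `0 < x` and takes each basis vector `e` to `e` (`exists_signMap_eq_single`). Each
prime ideal then turns the free space into a totally ordered quotient
(`IsSignMapOn.exists_residue`). The vector lattice `F` is generated by the image of the free space
in the product of these quotients. The primes at which an element of `F` is `≤ 0` are those
containing some element of `L`, which yields the homomorphism (`exists_latticeHom_of_support`); the
positive part of the image of `e` is sent to `e`.

The map `a` is built by transfinite induction. As `#L ≤ ℵ₁` and `𝕜` is countable, each stage has a
countable domain. Adjoining a vector amounts to placing a cut in a countable `L`-valued preorder
(`IsLatticePreorder.exists_cut`), and complete normality allows the cut to be fixed at one more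
point (`IsPartialCut.exists_insert`). -/

theorem exists_prime_of_not_le {x y : L} (h : ¬ x ≤ y) :
    ∃ P : Order.Ideal L, P.IsPrime ∧ y ∈ P ∧ x ∉ P := by
  have hd : Disjoint ((Order.PFilter.principal x : Order.PFilter L) : Set L)
      (Order.Ideal.principal y : Set L) := by
    rw [Set.disjoint_left]
    intro z hz hz'
    exact h ((Order.PFilter.mem_principal.1 hz).trans (Order.Ideal.mem_principal.1 hz'))
  obtain ⟨P, hP, hyP, hPd⟩ := DistribLattice.prime_ideal_of_disjoint_filter_ideal hd
  exact ⟨P, hP, hyP (Order.Ideal.mem_principal.2 le_rfl),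
    fun hx => Set.disjoint_left.1 hPd (Order.PFilter.mem_principal.2 le_rfl) hx⟩

theorem le_of_forall_prime {x y : L} (h : ∀ P : Order.Ideal L, P.IsPrime → y ∈ P → x ∈ P) :
    x ≤ y := by
  by_contra hxy
  obtain ⟨P, hP, hy, hx⟩ := exists_prime_of_not_le hxy
  exact hx (h P hP hy)

theorem Order.Ideal.IsPrime.inf_mem_iff {P : Order.Ideal L} (hP : P.IsPrime) {x y : L} :
    x ⊓ y ∈ P ↔ x ∈ P ∨ y ∈ P :=
  ⟨hP.mem_or_mem, fun h => h.elim (P.lower inf_le_left) (P.lower inf_le_right)⟩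

theorem Order.Ideal.IsPrime.finset_inf'_mem_iff {P : Order.Ideal L} (hP : P.IsPrime) {ι : Type*}
    {s : Finset ι} (hs : s.Nonempty) (f : ι → L) : s.inf' hs f ∈ P ↔ ∃ i ∈ s, f i ∈ P := by
  induction hs using Finset.Nonempty.cons_induction with
  | singleton a => simp
  | cons a s ha hs ih => simp [Finset.inf'_cons hs, hP.inf_mem_iff, ih]

end Prime

/-! ### Adding a cut to a lattice-valued preorder -/

section Cut

variable {L : Type*} [DistribLattice L] [OrderBot L] {X : Type*}

/-- An `L`-valued total preorder; `d s t` is the truth value of `t < s`. -/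
structure IsLatticePreorder (d : X → X → L) : Prop where
  inf_swap : ∀ s t, d s t ⊓ d t s = ⊥
  le_sup : ∀ s r t, d s t ≤ d s r ⊔ d r t

/-- Value of a cut at a point `pt`: `up` is the truth value of "the cut is above `pt`",
`down` of "the cut is below `pt`". -/
structure CutValue (X L : Type*) where
  pt : X
  up : L
  down : L

/-- Two values of a cut are compatible with the preorder `d`. -/
def CutValue.Compatible (d : X → X → L) (p q : CutValue X L) : Prop :=
  p.up ≤ q.up ⊔ d q.pt p.pt ∧ p.down ≤ q.down ⊔ d p.pt q.pt ∧ d q.pt p.pt ≤ p.up ⊔ q.down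

/-- A finite partial cut. -/
structure IsPartialCut (d : X → X → L) (s : Finset (CutValue X L)) : Prop where
  nonempty : s.Nonempty
  inf_eq : ∀ p ∈ s, p.up ⊓ p.down = ⊥
  compatible : ∀ p ∈ s, ∀ q ∈ s, p.Compatible d q

theorem IsLatticePreorder.self {d : X → X → L} (hd : IsLatticePreorder d) (s : X) :
    d s s = ⊥ := by simpa using hd.inf_swap s s

/-- This is where complete normality enters: the bounds imposed on `up` and `down` at the new point
may overlap, and consonance shrinks them to disjoint values without losing the required lower
bounds. -/
theorem IsPartialCut.exists_insert (hL : CompletelyNormalLattice L) {d : X → X → L}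
    (hd : IsLatticePreorder d) {s : Finset (CutValue X L)} (hs : IsPartialCut d s) (v : X) :
    ∃ p : CutValue X L, p.pt = v ∧ p.up ⊓ p.down = ⊥ ∧
      ∀ q ∈ s, p.Compatible d q ∧ q.Compatible d p := by
  obtain ⟨hne, hinf, hcomp⟩ := hs
  -- `A` and `B` are the largest values of `up` and `down` at `v` that the first two compatibility
  -- conditions permit.
  set A := s.inf' hne fun p => p.up ⊔ d p.pt v with hA
  set B := s.inf' hne fun p => p.down ⊔ d v p.pt with hB
  obtain ⟨x, y, hx, hy, hxy⟩ := hL A B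
  refine ⟨⟨v, x ⊓ A, y ⊓ B⟩, rfl, ?_, fun q hq => ?_⟩
  · rw [eq_bot_iff, ← hxy]
    exact inf_le_inf inf_le_left inf_le_left
  have memA : ∀ P : Order.Ideal L, P.IsPrime → (A ∈ P ↔ ∃ p ∈ s, p.up ∈ P ∧ d p.pt v ∈ P) := by
    intro P hP
    simp [hA, hP.finset_inf'_mem_iff]
  have memB : ∀ P : Order.Ideal L, P.IsPrime → (B ∈ P ↔ ∃ p ∈ s, p.down ∈ P ∧ d v p.pt ∈ P) := by
    intro P hP
    simp [hB, hP.finset_inf'_mem_iff]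
  have trans : ∀ (P : Order.Ideal L) (a r b : X), d a r ∈ P → d r b ∈ P → d a b ∈ P :=
    fun P a r b h h' => P.lower (hd.le_sup a r b) (Order.Ideal.sup_mem h h')
  have up : ∀ (P : Order.Ideal L), ∀ p ∈ s, ∀ q ∈ s, q.up ∈ P → d q.pt p.pt ∈ P → p.up ∈ P :=
    fun P p hp q hq h h' => P.lower (hcomp p hp q hq).1 (Order.Ideal.sup_mem h h')
  have down : ∀ (P : Order.Ideal L), ∀ p ∈ s, ∀ q ∈ s, q.down ∈ P → d p.pt q.pt ∈ P →
      p.down ∈ P :=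
    fun P p hp q hq h h' => P.lower (hcomp p hp q hq).2.1 (Order.Ideal.sup_mem h h')
  have tot : ∀ (P : Order.Ideal L), ∀ p ∈ s, ∀ q ∈ s, p.up ∈ P → q.down ∈ P →
      d q.pt p.pt ∈ P :=
    fun P p hp q hq h h' => P.lower (hcomp p hp q hq).2.2 (Order.Ideal.sup_mem h h')
  have alt : ∀ (P : Order.Ideal L), P.IsPrime → ∀ p ∈ s, p.up ∈ P ∨ p.down ∈ P :=
    fun P hP p hp => hP.mem_or_mem (by rw [hinf p hp]; exact P.bot_mem)
  have altd : ∀ (P : Order.Ideal L), P.IsPrime → ∀ a b, d a b ∈ P ∨ d b a ∈ P :=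
    fun P hP a b => hP.mem_or_mem (by rw [hd.inf_swap]; exact P.bot_mem)
  have hxP : ∀ P : Order.Ideal L, x ∈ P → B ∈ P → A ∈ P :=
    fun P h h' => P.lower hx (Order.Ideal.sup_mem h h')
  have hyP : ∀ P : Order.Ideal L, y ∈ P → A ∈ P → B ∈ P :=
    fun P h h' => P.lower hy (Order.Ideal.sup_mem h' h)
  refine ⟨⟨?_, ?_, ?_⟩, ?_, ?_, ?_⟩
  · exact inf_le_right.trans (Finset.inf'_le _ hq)
  · exact inf_le_right.trans (Finset.inf'_le _ hq)
  -- At a prime, each remaining inequality becomes propositional. If the factor `x` is false, either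
  -- the goal is immediate or `q` witnesses that `B` is false, and then `A ≤ x ⊔ B` makes `A` false.
  -- A witness `t ∈ s` for the falsity of `A` finishes by compatibility with `q`. The roles of `y`
  -- and `B` are symmetric.
  all_goals
    refine le_of_forall_prime fun P hP h => ?_
    simp only [Order.Ideal.sup_mem_iff, hP.inf_mem_iff] at h
  · obtain ⟨hxA, hqd⟩ := h
    have hA' : A ∈ P → d q.pt v ∈ P := fun h => by
      obtain ⟨t, ht, h1, h2⟩ := (memA P hP).1 h
      exact trans P _ _ _ (tot P t ht q hq h1 hqd) h2
    rcases hxA with hx' | h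
    · rcases altd P hP q.pt v with h | h
      · exact h
      · exact hA' (hxP P hx' ((memB P hP).2 ⟨q, hq, hqd, h⟩))
    · exact hA' h
  · obtain ⟨hxA, hvq⟩ := h
    have hA' : A ∈ P → q.up ∈ P := fun h => by
      obtain ⟨t, ht, h1, h2⟩ := (memA P hP).1 h
      exact up P q hq t ht h1 (trans P _ _ _ h2 hvq)
    rcases hxA with hx' | h
    · rcases alt P hP q hq with h | h
      · exact h
      · exact hA' (hxP P hx' ((memB P hP).2 ⟨q, hq, h, hvq⟩))
    · exact hA' h
  · obtain ⟨hyB, hqv⟩ := h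
    have hB' : B ∈ P → q.down ∈ P := fun h => by
      obtain ⟨t, ht, h1, h2⟩ := (memB P hP).1 h
      exact down P q hq t ht h1 (trans P _ _ _ hqv h2)
    rcases hyB with hy' | h
    · rcases alt P hP q hq with h | h
      · exact hB' (hyP P hy' ((memA P hP).2 ⟨q, hq, h, hqv⟩))
      · exact h
    · exact hB' h
  · obtain ⟨hqu, hyB⟩ := h
    have hB' : B ∈ P → d v q.pt ∈ P := fun h => by
      obtain ⟨t, ht, h1, h2⟩ := (memB P hP).1 h
      exact trans P _ _ _ h2 (tot P q hq t ht hqu h1)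
    rcases hyB with hy' | h
    · rcases altd P hP v q.pt with h | h
      · exact h
      · exact hB' (hyP P hy' ((memA P hP).2 ⟨q, hq, hqu, h⟩))
    · exact hB' h

/-- In a completely normal lattice, every `L`-valued total preorder on a countable set extends to
one more point, in prescribed position with respect to a given element. -/
theorem IsLatticePreorder.exists_cut [Countable X] (hL : CompletelyNormalLattice L)
    {d : X → X → L} (hd : IsLatticePreorder d) (x₀ : X) (e : L) :
    ∃ u w : X → L, u x₀ = e ∧ (∀ s, u s ⊓ w s = ⊥) ∧ (∀ s t, u s ≤ u t ⊔ d t s) ∧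
      (∀ s t, w s ≤ w t ⊔ d s t) ∧ ∀ s t, d t s ≤ u s ⊔ w t := by
  classical
  have hbase : IsPartialCut d {(⟨x₀, e, ⊥⟩ : CutValue X L)} := by
    refine ⟨Finset.singleton_nonempty _, by simp, ?_⟩
    simp [CutValue.Compatible, hd.self]
  let S := {s : Finset (CutValue X L) // IsPartialCut d s}
  have _ := Encodable.ofCountable X
  -- The partial cuts defined at `v` are cofinal; since `X` is countable, one ideal meets all these
  -- sets, and its members glue to a total cut.
  let D : X → Order.Cofinal S := fun v =>
    { carrier := {s | ∃ p ∈ s.1, p.pt = v}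
      isCofinal := fun s => by
        obtain ⟨p, hp, hp', hps⟩ := s.2.exists_insert hL hd v
        refine ⟨⟨insert p s.1, Finset.insert_nonempty _ _, ?_, ?_⟩,
          ⟨p, Finset.mem_insert_self _ _, hp⟩, Finset.subset_insert _ _⟩
        · intro q hq
          rcases Finset.mem_insert.1 hq with rfl | hq
          · exact hp'
          · exact s.2.inf_eq q hq
        · intro q hq r hr
          rcases Finset.mem_insert.1 hq with rfl | hqs <;>
            rcases Finset.mem_insert.1 hr with rfl | hrs
          · simp [CutValue.Compatible, hd.self]
          · exact (hps r hrs).1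
          · exact (hps q hqs).2
          · exact s.2.compatible q hqs r hrs }
  let I := Order.idealOfCofinals (⟨_, hbase⟩ : S) D
  have hI : ∀ v, ∃ p : CutValue X L, p.pt = v ∧ ∃ s ∈ I, p ∈ s.1 := fun v => by
    obtain ⟨s, ⟨p, hp, hv⟩, hs⟩ :=
      Order.cofinal_meets_idealOfCofinals (⟨_, hbase⟩ : S) D v
    exact ⟨p, hv, s, hs, hp⟩
  have hcomp : ∀ p q : CutValue X L, (∃ s ∈ I, p ∈ s.1) → (∃ s ∈ I, q ∈ s.1) →
      p.Compatible d q := by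
    rintro p q ⟨s, hs, hp⟩ ⟨t, ht, hq⟩
    obtain ⟨r, -, hsr, htr⟩ := I.directed s hs t ht
    exact r.2.compatible p (hsr hp) q (htr hq)
  choose c hc hcI using hI
  have h₀ : ∃ s ∈ I, (⟨x₀, e, ⊥⟩ : CutValue X L) ∈ s.1 :=
    ⟨_, Order.mem_idealOfCofinals (⟨_, hbase⟩ : S) D, Finset.mem_singleton_self _⟩
  refine ⟨fun v => (c v).up, fun v => (c v).down, ?_, ?_, ?_, ?_, ?_⟩
  -- The value chosen at `x₀` need not be the initial one, but compatible values at the same point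
  -- have equal `up`.
  · have h1 := (hcomp _ _ (hcI x₀) h₀).1
    have h2 := (hcomp _ _ h₀ (hcI x₀)).1
    simp only [hc, hd.self, sup_bot_eq] at h1 h2
    exact le_antisymm h1 h2
  · intro v
    obtain ⟨s, -, hp⟩ := hcI v
    exact s.2.inf_eq _ hp
  · intro s t
    simpa only [hc] using (hcomp _ _ (hcI s) (hcI t)).1
  · intro s t
    simpa only [hc] using (hcomp _ _ (hcI s) (hcI t)).2.1
  · intro s t
    simpa only [hc] using (hcomp _ _ (hcI s) (hcI t)).2.2

end Cut

/-! ### Sign maps -/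

section SignMap

variable {𝕜 : Type*} [DivisionRing 𝕜] [LinearOrder 𝕜] [IsStrictOrderedRing 𝕜]
  {L : Type*} [DistribLattice L] [OrderBot L] {W : Type*} [AddCommGroup W] [Module 𝕜 W]

/-- `a x` behaves on the subspace `U` as the truth value, in `L`, of the statement `0 < x`. -/
structure IsSignMapOn (U : Submodule 𝕜 W) (a : W → L) : Prop where
  smul : ∀ c : 𝕜, 0 < c → ∀ x ∈ U, a (c • x) = a x
  add : ∀ x ∈ U, ∀ y ∈ U, a (x + y) ≤ a x ⊔ a y
  inf_neg : ∀ x ∈ U, a x ⊓ a (-x) = ⊥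

namespace IsSignMapOn

theorem exists_cut (hL : CompletelyNormalLattice L) {U : Submodule 𝕜 W} [Countable U] {a : W → L}
    (ha : IsSignMapOn U a) (e : L) :
    ∃ u w : W → L, u 0 = e ∧ (∀ s ∈ U, u s ⊓ w s = ⊥) ∧
      (∀ s ∈ U, ∀ t ∈ U, u s ≤ u t ⊔ a (t - s)) ∧
      (∀ s ∈ U, ∀ t ∈ U, w s ≤ w t ⊔ a (s - t)) ∧
      ∀ s ∈ U, ∀ t ∈ U, a (t - s) ≤ u s ⊔ w t := by
  classical
  -- For the new vector `z`, `u s` will stand for `s < z` and `w s` for `z < s`.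
  have hd : IsLatticePreorder (fun s t : U => a (s - t)) := by
    refine ⟨fun s t => ?_, fun s r t => ?_⟩
    · simpa using ha.inf_neg (s - t) (U.sub_mem s.2 t.2)
    · simpa using ha.add (s - r) (U.sub_mem s.2 r.2) (r - t) (U.sub_mem r.2 t.2)
  obtain ⟨u, w, h0, h1, h2, h3, h4⟩ := hd.exists_cut hL 0 e
  refine ⟨fun s => if h : s ∈ U then u ⟨s, h⟩ else ⊥, fun s => if h : s ∈ U then w ⟨s, h⟩ else ⊥,
    ?_, ?_, ?_, ?_, ?_⟩
  · exact (dif_pos U.zero_mem).trans h0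
  · intro s hs
    simpa [hs] using h1 ⟨s, hs⟩
  · intro s hs t ht
    simpa [hs, ht] using h2 ⟨s, hs⟩ ⟨t, ht⟩
  · intro s hs t ht
    simpa [hs, ht] using h3 ⟨s, hs⟩ ⟨t, ht⟩
  · intro s hs t ht
    simpa [hs, ht] using h4 ⟨s, hs⟩ ⟨t, ht⟩

/-- In a completely normal lattice, a sign map on a countable subspace `U` extends to
`U ⊕ 𝕜 z`, with prescribed value at `z`. -/
theorem exists_extension (hL : CompletelyNormalLattice L) {U U' : Submodule 𝕜 W} [Countable U]
    {a : W → L} (ha : IsSignMapOn U a) (φ : W →ₗ[𝕜] 𝕜) {z : W} (hz : φ z = 1)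
    (hU : ∀ x ∈ U, φ x = 0) (hU' : ∀ x ∈ U', x - φ x • z ∈ U) (e : L) :
    ∃ a' : W → L, IsSignMapOn U' a' ∧ (∀ x ∈ U, a' x = a x) ∧ a' z = e := by
  classical
  obtain ⟨u, w, h0, hinf, hu, hw, hd⟩ := ha.exists_cut hL e
  -- When `φ x ≠ 0`, `x = φ x • (z - p x)`, so the sign of `x` is decided by the side of `p x` on
  -- which `z` lies.
  let p : W → W := fun x => -((φ x)⁻¹ • (x - φ x • z))
  have hp : ∀ x ∈ U', p x ∈ U := fun x hx => U.neg_mem (U.smul_mem _ (hU' x hx))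
  have hxp : ∀ x, φ x ≠ 0 → x = φ x • (z - p x) := fun x hx => by
    simp only [p, sub_neg_eq_add, smul_add, smul_inv_smul₀ hx]
    abel
  have hpeq : ∀ x m, φ x ≠ 0 → x = φ x • (z - m) → p x = m := fun x m hx h => by
    have h1 : φ x • (z - p x) = φ x • (z - m) := (hxp x hx).symm.trans h
    have h2 := smul_right_injective W hx h1
    simpa using h2
  have hx0 : ∀ x ∈ U', φ x = 0 → x ∈ U := fun x hx h => by simpa [h] using hU' x hx
  let a' : W → L := fun x => if φ x = 0 then a x else if 0 < φ x then u (p x) else w (p x)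
  have a'0 : ∀ x, φ x = 0 → a' x = a x := fun x h => by simp [a', h]
  have a'p : ∀ x, 0 < φ x → a' x = u (p x) := fun x h => by simp [a', h, h.ne']
  have a'n : ∀ x, φ x < 0 → a' x = w (p x) := fun x h => by simp [a', h.ne, h.not_gt]
  have hscale : ∀ c : 𝕜, 0 < c → ∀ s ∈ U, ∀ t ∈ U, ∀ r ∈ U, ∀ q ∈ U, r - q = c • (s - t) →
      a (r - q) = a (s - t) := fun c hc s hs t ht r hr q hq h => by
    rw [h, ha.smul c hc _ (U.sub_mem hs ht)]
  have hpadd : ∀ x y, φ x ≠ 0 → φ y ≠ 0 → φ x + φ y ≠ 0 →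
      (p x - p (x + y) = ((φ x + φ y)⁻¹ * φ y) • (p x - p y)) ∧
      (p (x + y) - p x = ((φ x + φ y)⁻¹ * φ y) • (p y - p x)) := by
    intro x y hx hy hxy
    have key : p (x + y) = p x + ((φ x + φ y)⁻¹ * φ y) • (p y - p x) := by
      refine hpeq _ _ (by rwa [map_add]) ?_
      rw [map_add, ← sub_sub, smul_sub, ← mul_smul, ← mul_assoc, mul_inv_cancel₀ hxy, one_mul]
      nth_rw 1 [hxp x hx, hxp y hy]
      simp only [add_smul, smul_sub]
      abel
    rw [key]
    constructor
    · rw [← neg_sub (p y) (p x), smul_neg]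
      abel
    · abel
  have zero_add : ∀ x ∈ U', ∀ y ∈ U', φ x ≠ 0 → φ y = 0 → a' (x + y) ≤ a' x ⊔ a' y := by
    intro x hx y hy h h'
    have hyU := hx0 y hy h'
    have e1 : φ (x + y) = φ x := by rw [map_add, h', add_zero]
    have key : p (x + y) = p x - (φ x)⁻¹ • y := by
      refine hpeq _ _ (by rwa [e1]) ?_
      rw [e1]
      nth_rw 1 [hxp x h]
      simp only [smul_sub, smul_inv_smul₀ h]
      abel
    have hxy := hp _ (U'.add_mem hx hy)
    rw [a'0 y h']
    rcases lt_or_gt_of_ne h with hn | hn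
    · rw [a'n x hn, a'n _ (by rwa [e1])]
      refine (hw _ hxy _ (hp x hx)).trans (sup_le_sup_left (le_of_eq ?_) _)
      rw [key, show p x - (φ x)⁻¹ • y - p x = (-(φ x)⁻¹) • y by rw [neg_smul]; abel]
      exact ha.smul _ (by simpa using hn) _ hyU
    · rw [a'p x hn, a'p _ (by rwa [e1])]
      refine (hu _ hxy _ (hp x hx)).trans (sup_le_sup_left (le_of_eq ?_) _)
      rw [key, show p x - (p x - (φ x)⁻¹ • y) = (φ x)⁻¹ • y by abel]
      exact ha.smul _ (by simpa using hn) _ hyU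
  -- If `φ x + φ y ≠ 0`, the point `p (x + y)` lies outside the segment from `p x` to `p y`, so
  -- passing to it from the nearer end costs only the truth value of `p x < p y`. That value is
  -- below `a' x ⊔ a' y`, since `z` lies above `p x` or below `p y`.
  have pos_neg : ∀ x ∈ U', ∀ y ∈ U', 0 < φ x → φ y < 0 → a' (x + y) ≤ a' x ⊔ a' y := by
    intro x hx y hy h h'
    have hxy := hp _ (U'.add_mem hx hy)
    have hpx := hp x hx
    have hpy := hp y hy
    have hdxy : a (p y - p x) ≤ a' x ⊔ a' y := by
      rw [a'p x h, a'n y h']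
      exact hd _ hpx _ hpy
    rcases lt_trichotomy (φ x + φ y) 0 with hs | hs | hs
    · rw [a'n (x + y) (by rwa [map_add])]
      refine (hw _ hxy _ hpy).trans (sup_le ?_ ?_)
      · rw [a'n y h']
        exact le_sup_right
      · have h1 := (hpadd y x h'.ne h.ne' (by rw [add_comm]; exact hs.ne)).2
        rw [add_comm y x, ← neg_sub (p y) (p x), smul_neg, ← neg_smul] at h1
        rw [hscale _ ?_ _ hpy _ hpx _ hxy _ hpy h1]
        · exact hdxy
        · rw [add_comm (φ y), neg_pos]
          exact mul_neg_of_neg_of_pos (inv_lt_zero.2 hs) h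
    · rw [a'0 (x + y) (by rwa [map_add])]
      have h1 : x + y = φ x • (p y - p x) := by
        have h2 := hxp y h'.ne
        rw [show φ y = - φ x from (neg_eq_of_add_eq_zero_right hs).symm] at h2
        nth_rw 1 [hxp x h.ne', h2]
        simp only [smul_sub, neg_smul]
        abel
      rw [h1, ha.smul _ h _ (U.sub_mem hpy hpx)]
      exact hdxy
    · rw [a'p (x + y) (by rwa [map_add])]
      refine (hu _ hxy _ hpx).trans (sup_le ?_ ?_)
      · rw [a'p x h]
        exact le_sup_left
      · have h1 := (hpadd x y h.ne' h'.ne hs.ne').1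
        rw [← neg_sub (p y) (p x), smul_neg, ← neg_smul] at h1
        rw [hscale _ ?_ _ hpy _ hpx _ hpx _ hxy h1]
        · exact hdxy
        · rw [neg_pos]
          exact mul_neg_of_pos_of_neg (inv_pos.2 hs) h'
  refine ⟨a', ⟨?_, ?_, ?_⟩, fun x hx => a'0 x (hU x hx), ?_⟩
  · intro c hc x hx
    rcases lt_trichotomy (φ x) 0 with h | h | h
    · have h' : φ (c • x) < 0 := by
        rw [map_smul, smul_eq_mul]
        exact mul_neg_of_pos_of_neg hc h
      rw [a'n _ h', a'n _ h, hpeq (c • x) (p x) h'.ne]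
      nth_rw 1 [hxp x h.ne, map_smul, smul_eq_mul, mul_smul]
    · rw [a'0 _ h, a'0 _ (by rw [map_smul, h, smul_zero]), ha.smul c hc _ (hx0 x hx h)]
    · have h' : 0 < φ (c • x) := by
        rw [map_smul, smul_eq_mul]
        exact mul_pos hc h
      rw [a'p _ h', a'p _ h, hpeq (c • x) (p x) h'.ne']
      nth_rw 1 [hxp x h.ne', map_smul, smul_eq_mul, mul_smul]
  · intro x hx y hy
    have hxy := hp _ (U'.add_mem hx hy)
    have hpx := hp x hx
    have hpy := hp y hy
    -- For equal signs `p (x + y)` lies between `p x` and `p y`. Comparison with each end leaves an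
    -- error term; the two errors are disjoint, so distributivity removes them.
    have hdisj : ∀ b : L, b ≤ (a' x ⊔ a' y) ⊔ a (p x - p y) →
        b ≤ (a' x ⊔ a' y) ⊔ a (p y - p x) → b ≤ a' x ⊔ a' y := by
      intro b h1 h2
      have h3 := ha.inf_neg _ (U.sub_mem hpx hpy)
      rw [neg_sub] at h3
      simpa [← sup_inf_left, h3] using le_inf h1 h2
    rcases eq_or_ne (φ x) 0 with h | h
    · rcases eq_or_ne (φ y) 0 with h' | h'
      · rw [a'0 _ h, a'0 _ h', a'0 _ (by rw [map_add, h, h', add_zero])]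
        exact ha.add x (hx0 x hx h) y (hx0 y hy h')
      · rw [add_comm x, sup_comm]
        exact zero_add y hy x hx h' h
    rcases eq_or_ne (φ y) 0 with h' | h'
    · exact zero_add x hx y hy h h'
    rcases lt_or_gt_of_ne h with h | h <;> rcases lt_or_gt_of_ne h' with h' | h'
    · have hs : φ x + φ y < 0 := add_neg h h'
      have hs' : φ y + φ x < 0 := add_neg h' h
      rw [a'n (x + y) (by rwa [map_add])]
      have h1 := (hpadd x y h.ne h'.ne hs.ne).2
      have h2 := (hpadd y x h'.ne h.ne hs'.ne).2
      rw [add_comm y x] at h2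
      refine hdisj _ ((hw _ hxy _ hpy).trans (sup_le_sup ?_ ?_))
        ((hw _ hxy _ hpx).trans (sup_le_sup ?_ ?_))
      · rw [a'n y h']
        exact le_sup_right
      · exact (hscale _ (mul_pos_of_neg_of_neg (inv_lt_zero.2 hs') h)
          _ hpx _ hpy _ hxy _ hpy h2).le
      · rw [a'n x h]
        exact le_sup_left
      · exact (hscale _ (mul_pos_of_neg_of_neg (inv_lt_zero.2 hs) h')
          _ hpy _ hpx _ hxy _ hpx h1).le
    · rw [add_comm x, sup_comm]
      exact pos_neg y hy x hx h' h
    · exact pos_neg x hx y hy h h'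
    · have hs : 0 < φ x + φ y := add_pos h h'
      have hs' : 0 < φ y + φ x := add_pos h' h
      rw [a'p (x + y) (by rwa [map_add])]
      have h1 := (hpadd x y h.ne' h'.ne' hs.ne').1
      have h2 := (hpadd y x h'.ne' h.ne' hs'.ne').1
      rw [add_comm y x] at h2
      refine hdisj _ ((hu _ hxy _ hpx).trans (sup_le_sup ?_ ?_))
        ((hu _ hxy _ hpy).trans (sup_le_sup ?_ ?_))
      · rw [a'p x h]
        exact le_sup_left
      · exact (hscale _ (mul_pos (inv_pos.2 hs) h') _ hpx _ hpy _ hpx _ hxy h1).le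
      · rw [a'p y h']
        exact le_sup_right
      · exact (hscale _ (mul_pos (inv_pos.2 hs') h) _ hpy _ hpx _ hpy _ hxy h2).le
  · intro x hx
    have hpn : φ x ≠ 0 → p (-x) = p x := fun h => by
      refine hpeq _ _ (by simpa using h) ?_
      nth_rw 1 [hxp x h, map_neg, neg_smul]
    rcases lt_trichotomy (φ x) 0 with h | h | h
    · rw [a'n _ h, a'p _ (by simpa using h), hpn h.ne, inf_comm]
      exact hinf _ (hp x hx)
    · rw [a'0 _ h, a'0 _ (by simpa using h)]
      exact ha.inf_neg x (hx0 x hx h)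
    · rw [a'p _ h, a'n _ (by simpa using h), hpn h.ne']
      exact hinf _ (hp x hx)
  · rw [a'p z (by rw [hz]; exact zero_lt_one), ← h0]
    simp [p, hz]

end IsSignMapOn

end SignMap

/-! ### Sign maps with all values, for lattices of cardinality at most `ℵ₁` -/

section Global

variable {𝕜 : Type u} [DivisionRing 𝕜] [LinearOrder 𝕜] [IsStrictOrderedRing 𝕜]
  {L : Type v} [DistribLattice L] [OrderBot L]

/-- A sign map defined over an initial segment `T` of `L` for the relation `r`. -/
structure IsSegmentSignMap (𝕜 : Type u) [DivisionRing 𝕜] [LinearOrder 𝕜] [IsStrictOrderedRing 𝕜]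
    {L : Type v} [DistribLattice L] [OrderBot L] (r : L → L → Prop)
    (p : Set L × ((L →₀ 𝕜) → L)) : Prop where
  initial : ∀ x ∈ p.1, ∀ y, r y x → y ∈ p.1
  sign : IsSignMapOn (Finsupp.supported 𝕜 𝕜 p.1) p.2
  single : ∀ e ∈ p.1, p.2 (Finsupp.single e 1) = e

theorem exists_signMap_eq_single [Countable 𝕜] (hL : CompletelyNormalLattice L)
    (hcard : #L ≤ ℵ₁) :
    ∃ a : (L →₀ 𝕜) → L, IsSignMapOn (⊤ : Submodule 𝕜 (L →₀ 𝕜)) a ∧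
      ∀ e, a (Finsupp.single e 1) = e := by
  classical
  obtain ⟨r, hr, hord⟩ := Cardinal.exists_ord_eq L
  let S := {p : Set L × ((L →₀ 𝕜) → L) // IsSegmentSignMap 𝕜 r p}
  let R : S → S → Prop := fun p q =>
    p.1.1 ⊆ q.1.1 ∧ ∀ x ∈ Finsupp.supported 𝕜 𝕜 p.1.1, q.1.2 x = p.1.2 x
  have mono : ∀ {s t : Set L}, s ⊆ t → Finsupp.supported 𝕜 𝕜 s ≤ Finsupp.supported 𝕜 𝕜 t :=
    fun h => Finsupp.supported_mono h
  -- `R` is only a preorder, because values outside the supported subspace are irrelevant.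
  obtain ⟨m, hm⟩ : ∃ m : S, ∀ q, R m q → R q m := by
    refine exists_maximal_of_chains_bounded (r := R) (fun c hc => ?_)
      fun {p q s} hpq hqs => ⟨hpq.1.trans hqs.1, fun x hx =>
        (hqs.2 x (mono hpq.1 hx)).trans (hpq.2 x hx)⟩
    have hdir : ∀ p ∈ c, ∀ q ∈ c, ∃ s ∈ c, R p s ∧ R q s := by
      intro p hp q hq
      rcases eq_or_ne p q with rfl | hne
      · exact ⟨p, hp, ⟨subset_rfl, fun _ _ => rfl⟩, ⟨subset_rfl, fun _ _ => rfl⟩⟩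
      · rcases hc hp hq hne with h | h
        · exact ⟨q, hq, h, ⟨subset_rfl, fun _ _ => rfl⟩⟩
        · exact ⟨p, hp, ⟨subset_rfl, fun _ _ => rfl⟩, h⟩
    let T : Set L := ⋃ p ∈ c, p.1.1
    let a : (L →₀ 𝕜) → L := fun x =>
      if h : ∃ p ∈ c, x ∈ Finsupp.supported 𝕜 𝕜 p.1.1 then h.choose.1.2 x else ⊥
    have ha : ∀ p ∈ c, ∀ x ∈ Finsupp.supported 𝕜 𝕜 p.1.1, a x = p.1.2 x := by
      intro p hp x hx
      have h : ∃ p ∈ c, x ∈ Finsupp.supported 𝕜 𝕜 p.1.1 := ⟨p, hp, hx⟩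
      obtain ⟨s, -, h1, h2⟩ := hdir p hp _ h.choose_spec.1
      rw [show a x = h.choose.1.2 x from dif_pos h, ← h1.2 x hx, h2.2 x h.choose_spec.2]
    have hTsub : ∀ p ∈ c, p.1.1 ⊆ T := fun p hp =>
      Set.subset_biUnion_of_mem (u := fun p : S => p.1.1) hp
    have hT : c.Nonempty → ∀ x ∈ Finsupp.supported 𝕜 𝕜 T,
        ∃ p ∈ c, x ∈ Finsupp.supported 𝕜 𝕜 p.1.1 := by
      intro hne x hx
      have hd : DirectedOn (Function.onFun (· ⊆ ·) fun p : S => p.1.1) c := fun p hp q hq => by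
        obtain ⟨s, hs, h1, h2⟩ := hdir p hp q hq
        exact ⟨s, hs, h1.1, h2.1⟩
      exact hd.exists_mem_subset_of_finset_subset_biUnion hne ((Finsupp.mem_supported 𝕜 x).1 hx)
    rcases c.eq_empty_or_nonempty with rfl | hne
    · refine ⟨⟨(∅, fun _ => ⊥), ⟨by simp, ⟨?_, ?_, ?_⟩, by simp⟩⟩, by simp⟩ <;> simp
    · refine ⟨⟨(T, a), ⟨?_, ⟨?_, ?_, ?_⟩, ?_⟩⟩, fun p hp => ⟨hTsub p hp, ha p hp⟩⟩
      · intro x hx y hyx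
        obtain ⟨p, hp, hxp⟩ := Set.mem_iUnion₂.1 hx
        exact hTsub p hp (p.2.initial x hxp y hyx)
      · intro b hb x hx
        obtain ⟨p, hp, hxp⟩ := hT hne x hx
        simp only
        rw [ha p hp x hxp, ha p hp _ (Submodule.smul_mem _ _ hxp)]
        exact p.2.sign.smul b hb x hxp
      · intro x hx y hy
        obtain ⟨p, hp, hxp⟩ := hT hne x hx
        obtain ⟨q, hq, hyq⟩ := hT hne y hy
        obtain ⟨s, hs, h1, h2⟩ := hdir p hp q hq
        have hxs := mono h1.1 hxp
        have hys := mono h2.1 hyq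
        simp only
        rw [ha s hs x hxs, ha s hs y hys, ha s hs _ (Submodule.add_mem _ hxs hys)]
        exact s.2.sign.add x hxs y hys
      · intro x hx
        obtain ⟨p, hp, hxp⟩ := hT hne x hx
        simp only
        rw [ha p hp x hxp, ha p hp _ (Submodule.neg_mem _ hxp)]
        exact p.2.sign.inf_neg x hxp
      · intro e he
        obtain ⟨p, hp, hep⟩ := Set.mem_iUnion₂.1 he
        exact (ha p hp _ (Finsupp.single_mem_supported 𝕜 1 hep)).trans (p.2.single e hep)
  have huniv : m.1.1 = Set.univ := by
    by_contra hne
    obtain ⟨e, he, hmin⟩ := (IsWellFounded.wf (r := r)).has_min (m.1.1)ᶜ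
      (Set.nonempty_compl.2 hne)
    have hlt : ∀ x ∈ m.1.1, r x e := fun x hx => by
      rcases trichotomous_of r x e with h | h | h
      · exact h
      · exact absurd (h ▸ hx) he
      · exact absurd (m.2.initial x hx e h) he
    -- The order type of `r` is the initial ordinal of `#L`, so `e` has fewer than `ℵ₁`
    -- predecessors.
    have hcount : m.1.1.Countable := by
      refine Set.Countable.mono (s₂ := {x | r x e}) hlt ?_
      rw [← Cardinal.le_aleph0_iff_set_countable, ← Cardinal.lt_aleph_one_iff]
      exact (Cardinal.card_typein_lt e hord).trans_le hcard
    have : Countable m.1.1 := hcount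
    have : Countable (Finsupp.supported 𝕜 𝕜 m.1.1) :=
      (Finsupp.supportedEquivFinsupp (R := 𝕜) (M := 𝕜) m.1.1).toEquiv.countable_iff.2 inferInstance
    obtain ⟨a', h1, h2, h3⟩ : ∃ a' : (L →₀ 𝕜) → L,
        IsSignMapOn (Finsupp.supported 𝕜 𝕜 (insert e m.1.1)) a' ∧
        (∀ x ∈ Finsupp.supported 𝕜 𝕜 m.1.1, a' x = m.1.2 x) ∧ a' (Finsupp.single e 1) = e := by
      refine m.2.sign.exists_extension hL (Finsupp.lapply e) (by simp) ?_ ?_ e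
      · intro x hx
        exact Finsupp.notMem_support_iff.1 fun h => he (hx h)
      · intro x hx y hy
        have hye : y ≠ e := by
          rintro rfl
          simp at hy
        have hyx : y ∈ x.support := by
          simpa [Finsupp.single_apply, hye.symm] using hy
        exact (hx hyx).resolve_left hye
    have hq : IsSegmentSignMap 𝕜 r (insert e m.1.1, a') := by
      refine ⟨?_, h1, ?_⟩
      · rintro x (rfl | hx) y hyx
        · by_contra h
          exact hmin y (fun h' => h (Set.mem_insert_of_mem _ h')) hyx
        · exact Set.mem_insert_of_mem _ (m.2.initial x hx y hyx)
      · rintro x (rfl | hx)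
        · exact h3
        · exact (h2 _ (Finsupp.single_mem_supported 𝕜 1 hx)).trans (m.2.single x hx)
    exact he ((hm ⟨_, hq⟩ ⟨Set.subset_insert _ _, h2⟩).1 (Set.mem_insert _ _))
  refine ⟨m.1.2, ?_, fun e => m.2.single e (huniv ▸ Set.mem_univ e)⟩
  have := m.2.sign
  rwa [huniv, Finsupp.supported_univ] at this

end Global

/-! ### The vector lattice of a sign map -/

section Residue

variable {𝕜 : Type*} [DivisionRing 𝕜] [LinearOrder 𝕜] [IsStrictOrderedRing 𝕜]
  {L : Type*} [DistribLattice L] [OrderBot L] {W : Type*} [AddCommGroup W] [Module 𝕜 W]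

theorem IsSignMapOn.zero {U : Submodule 𝕜 W} {a : W → L} (ha : IsSignMapOn U a) : a 0 = ⊥ := by
  simpa using ha.inf_neg 0 U.zero_mem

/-- A sign map induces, at each prime ideal, a totally ordered vector space. -/
theorem IsSignMapOn.exists_residue {a : W → L} (ha : IsSignMapOn (⊤ : Submodule 𝕜 W) a)
    {P : Order.Ideal L} (hP : P.IsPrime) :
    ∃ (N : Submodule 𝕜 W) (_ : LinearOrder (W ⧸ N)) (_ : IsOrderedAddMonoid (W ⧸ N))
      (_ : IsOrderedModule 𝕜 (W ⧸ N)), ∀ x, N.mkQ x ≤ 0 ↔ a x ∈ P := by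
  classical
  have add : ∀ x y, a x ∈ P → a y ∈ P → a (x + y) ∈ P := fun x y hx hy =>
    P.lower (ha.add x trivial y trivial) (Order.Ideal.sup_mem hx hy)
  have zero : a 0 ∈ P := by
    rw [ha.zero]
    exact P.bot_mem
  have smul : ∀ (c : 𝕜) x, 0 ≤ c → a x ∈ P → a (c • x) ∈ P := by
    intro c x hc hx
    rcases hc.eq_or_lt with rfl | hc
    · rwa [zero_smul]
    · rwa [ha.smul c hc x trivial]
  have tot : ∀ x, a x ∈ P ∨ a (-x) ∈ P := fun x =>
    hP.mem_or_mem (by rw [ha.inf_neg x trivial]; exact P.bot_mem)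
  let N : Submodule 𝕜 W :=
    { carrier := {x | a x ∈ P ∧ a (-x) ∈ P}
      zero_mem' := ⟨zero, by rwa [neg_zero]⟩
      add_mem' := fun {x y} hx hy => ⟨add x y hx.1 hy.1, by
        rw [neg_add]
        exact add _ _ hx.2 hy.2⟩
      smul_mem' := fun c x hx => by
        rcases le_total 0 c with hc | hc
        · exact ⟨smul c x hc hx.1, by rw [← smul_neg]; exact smul c _ hc hx.2⟩
        · refine ⟨?_, ?_⟩
          · rw [← neg_smul_neg]
            exact smul _ _ (neg_nonneg.2 hc) hx.2
          · rw [← neg_smul]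
            exact smul _ _ (neg_nonneg.2 hc) hx.1 }
  let C : AddGroupCone (W ⧸ N) :=
    { carrier := {q | ∃ x, N.mkQ x = q ∧ a (-x) ∈ P}
      zero_mem' := ⟨0, map_zero _, by rwa [neg_zero]⟩
      add_mem' := by
        rintro _ _ ⟨x, rfl, hx⟩ ⟨y, rfl, hy⟩
        exact ⟨x + y, map_add _ _ _, by rw [neg_add]; exact add _ _ hx hy⟩
      eq_zero_of_mem_of_neg_mem' := by
        rintro _ ⟨x, rfl, hx⟩ ⟨y, hy, hy'⟩
        rw [← map_neg, ← sub_eq_zero, ← map_sub] at hy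
        have h := (Submodule.Quotient.mk_eq_zero N).1 hy
        refine (Submodule.Quotient.mk_eq_zero N).2 ⟨?_, hx⟩
        have := add _ _ h.1 hy'
        rwa [show y - -x + -y = x by abel] at this }
  -- Membership in the cone does not depend on the representative: elements of `N` are neither
  -- positive nor negative at `P`.
  have hCmem : ∀ x, N.mkQ x ∈ C ↔ a (-x) ∈ P := by
    refine fun x => ⟨?_, fun h => ⟨x, rfl, h⟩⟩
    rintro ⟨y, hy, hy'⟩
    rw [← sub_eq_zero, ← map_sub] at hy
    have := add _ _ ((Submodule.Quotient.mk_eq_zero N).1 hy).1 hy'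
    rwa [show y - x + -y = -x by abel] at this
  have : AddGroupConeClass (AddGroupCone (W ⧸ N)) (W ⧸ N) := inferInstance
  have : HasMemOrNegMem C := ⟨fun q => by
    obtain ⟨x, rfl⟩ := N.mkQ_surjective q
    rw [← map_neg, hCmem, hCmem, neg_neg]
    exact (tot x).symm⟩
  let inst : LinearOrder (W ⧸ N) := LinearOrder.mkOfAddGroupCone C
  have hle : ∀ x y : W ⧸ N, x ≤ y ↔ y - x ∈ C := fun _ _ => Iff.rfl
  have hmon : IsOrderedAddMonoid (W ⧸ N) :=
    ⟨fun x y h z => by rwa [hle, add_sub_add_right_eq_sub],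
     fun x y h z => by rwa [hle, add_sub_add_left_eq_sub]⟩
  refine ⟨N, inst, hmon, IsOrderedModule.of_smul_nonneg fun c hc q hq => ?_, fun x => ?_⟩
  · obtain ⟨x, rfl⟩ := N.mkQ_surjective q
    rw [hle, sub_zero, hCmem] at hq
    rw [hle, sub_zero, ← map_smul, hCmem, ← smul_neg]
    exact smul _ _ hc hq
  · rw [hle, zero_sub, ← map_neg, hCmem, neg_neg]

end Residue

/-! ### Vector sublattices generated by subspaces -/

section Generated

variable {𝕜 : Type*} [DivisionRing 𝕜] [LinearOrder 𝕜] [IsStrictOrderedRing 𝕜]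
  {E : Type*} [AddCommGroup E] [Lattice E] [IsOrderedAddMonoid E] [Module 𝕜 E]
  [IsOrderedModule 𝕜 E]

theorem smul_sup_of_pos {c : 𝕜} (hc : 0 < c) (x y : E) : c • (x ⊔ y) = c • x ⊔ c • y := by
  refine le_antisymm ?_ (sup_le (smul_le_smul_of_nonneg_left le_sup_left hc.le)
    (smul_le_smul_of_nonneg_left le_sup_right hc.le))
  have key : ∀ z, c • x ⊔ c • y = z → x ⊔ y ≤ c⁻¹ • z := by
    rintro _ rfl
    have hc' : 0 ≤ c⁻¹ := inv_nonneg.2 hc.le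
    refine sup_le ?_ ?_
    · simpa [inv_smul_smul₀ hc.ne'] using
        smul_le_smul_of_nonneg_left (le_sup_left : c • x ≤ c • x ⊔ c • y) hc'
    · simpa [inv_smul_smul₀ hc.ne'] using
        smul_le_smul_of_nonneg_left (le_sup_right : c • y ≤ c • x ⊔ c • y) hc'
  simpa [smul_inv_smul₀ hc.ne'] using smul_le_smul_of_nonneg_left (key _ rfl) hc.le

theorem smul_inf_of_pos {c : 𝕜} (hc : 0 < c) (x y : E) : c • (x ⊓ y) = c • x ⊓ c • y := by
  rw [← neg_inj, ← smul_neg, neg_inf, neg_inf, smul_sup_of_pos hc, smul_neg, smul_neg]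

/-- The vector sublattice generated by a subspace. -/
def Submodule.latticeSpan (V : Submodule 𝕜 E) : Submodule 𝕜 E where
  carrier := latticeClosure (V : Set E)
  zero_mem' := subset_latticeClosure V.zero_mem
  -- Translations and positive scalings preserve joins and meets, and negation exchanges them, so
  -- closure passes from `V` to its lattice closure by induction.
  add_mem' := by
    intro x y hx hy
    induction hx using latticeClosure_sup_inf_induction with
    | mem x hx =>
      induction hy using latticeClosure_sup_inf_induction with
      | mem y hy => exact subset_latticeClosure (V.add_mem hx hy)
      | sup y _ z _ h1 h2 =>
        rw [add_sup]
        exact isSublattice_latticeClosure.supClosed h1 h2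
      | inf y _ z _ h1 h2 =>
        rw [add_inf]
        exact isSublattice_latticeClosure.infClosed h1 h2
    | sup x _ z _ h1 h2 =>
      rw [sup_add]
      exact isSublattice_latticeClosure.supClosed h1 h2
    | inf x _ z _ h1 h2 =>
      rw [inf_add]
      exact isSublattice_latticeClosure.infClosed h1 h2
  smul_mem' := by
    have hneg : ∀ x ∈ latticeClosure (V : Set E), -x ∈ latticeClosure (V : Set E) := by
      intro x hx
      induction hx using latticeClosure_sup_inf_induction with
      | mem x hx => exact subset_latticeClosure (V.neg_mem hx)
      | sup x _ z _ h1 h2 =>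
        rw [_root_.neg_sup]
        exact isSublattice_latticeClosure.infClosed h1 h2
      | inf x _ z _ h1 h2 =>
        rw [_root_.neg_inf]
        exact isSublattice_latticeClosure.supClosed h1 h2
    have hpos : ∀ c : 𝕜, 0 < c → ∀ x ∈ latticeClosure (V : Set E),
        c • x ∈ latticeClosure (V : Set E) := by
      intro c hc x hx
      induction hx using latticeClosure_sup_inf_induction with
      | mem x hx => exact subset_latticeClosure (V.smul_mem c hx)
      | sup x _ z _ h1 h2 =>
        rw [smul_sup_of_pos hc]
        exact isSublattice_latticeClosure.supClosed h1 h2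
      | inf x _ z _ h1 h2 =>
        rw [smul_inf_of_pos hc]
        exact isSublattice_latticeClosure.infClosed h1 h2
    intro c x hx
    rcases lt_trichotomy c 0 with hc | rfl | hc
    · rw [← neg_smul_neg]
      exact hpos _ (neg_pos.2 hc) _ (hneg x hx)
    · rw [zero_smul]
      exact subset_latticeClosure V.zero_mem
    · exact hpos c hc x hx

instance (V : Submodule 𝕜 E) : Lattice V.latticeSpan :=
  { (inferInstance : PartialOrder V.latticeSpan),
    Subtype.lattice (P := fun x => x ∈ V.latticeSpan)
      (fun _ _ hx hy => isSublattice_latticeClosure.supClosed hx hy)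
      (fun _ _ hx hy => isSublattice_latticeClosure.infClosed hx hy) with }

instance (V : Submodule 𝕜 E) : IsOrderedModule 𝕜 V.latticeSpan :=
  IsOrderedModule.of_smul_nonneg fun c hc x hx =>
    show (0 : E) ≤ c • (x : E) from smul_nonneg hc hx

end Generated

/-! ### From supports to the lattice homomorphism -/

section Representation

variable {𝕜 : Type*} [DivisionRing 𝕜] [LinearOrder 𝕜] [IsStrictOrderedRing 𝕜]
  {L : Type*} [DistribLattice L] [OrderBot L]
  {F : Type*} [AddCommGroup F] [Lattice F] [IsOrderedAddMonoid F] [Module 𝕜 F]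
  [IsOrderedModule 𝕜 F]

/-- A vector lattice whose elements have supports represented by elements of `L` has a lattice
homomorphism `Idc 𝕜 F → L`. Here `K P` is the set of elements that are `≤ 0` at the
prime ideal `P`. -/
theorem exists_latticeHom_of_support (K : Order.Ideal L → Set F) (ρ : F → L)
    (hρ : ∀ P : Order.Ideal L, P.IsPrime → ∀ g, ρ g ∈ P ↔ g ∈ K P)
    (hsup : ∀ P : Order.Ideal L, P.IsPrime → ∀ g h, g ⊔ h ∈ K P ↔ g ∈ K P ∧ h ∈ K P)
    (hinf : ∀ P : Order.Ideal L, P.IsPrime → ∀ g h, g ⊓ h ∈ K P ↔ g ∈ K P ∨ h ∈ K P)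
    (hzero : ∀ P : Order.Ideal L, P.IsPrime → (0 : F) ∈ K P)
    (hsmul : ∀ P : Order.Ideal L, P.IsPrime → ∀ c : 𝕜, 0 ≤ c → ∀ g ∈ K P, c • g ∈ K P) :
    ∃ f : LatticeHom (Idc 𝕜 F) L, f ⊥ = ⊥ ∧ ∀ g, f (Idc.mk 𝕜 g) = ρ |g| := by
  have hmono : ∀ {a b : F}, Idc.mk 𝕜 a ≤ Idc.mk 𝕜 b → ρ |a| ≤ ρ |b| := by
    intro a b hab
    obtain ⟨c, hc, h⟩ := Idc.mk_le_mk.1 hab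
    refine le_of_forall_prime fun P hP hb => ?_
    rw [hρ P hP] at hb ⊢
    have h1 := hsmul P hP c hc _ hb
    rw [← sup_eq_right.2 h, hsup P hP] at h1
    exact h1.1
  have hmk : ∀ g, ρ |(Idc.mk 𝕜 g).gen| = ρ |g| := fun g =>
    le_antisymm (hmono (Idc.mk_gen _).le) (hmono (Idc.mk_gen _).ge)
  have habs : ∀ {x : F}, 0 ≤ x → |x| = x := fun h => abs_of_nonneg h
  refine ⟨⟨⟨fun I => ρ |I.gen|, fun I J => ?_⟩, fun I J => ?_⟩, ?_, hmk⟩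
  · change ρ |(Idc.mk 𝕜 (|I.gen| ⊔ |J.gen|)).gen| = _
    rw [hmk, habs (le_sup_of_le_left (abs_nonneg _))]
    apply le_antisymm <;> refine le_of_forall_prime fun P hP h => ?_ <;>
      simpa only [Order.Ideal.sup_mem_iff, hρ P hP, hsup P hP] using h
  · change ρ |(Idc.mk 𝕜 (|I.gen| ⊓ |J.gen|)).gen| = _
    rw [hmk, habs (le_inf (abs_nonneg _) (abs_nonneg _))]
    apply le_antisymm <;> refine le_of_forall_prime fun P hP h => ?_ <;>
      simpa only [hP.inf_mem_iff, hρ P hP, hinf P hP] using h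
  · change ρ |(Idc.mk 𝕜 (0 : F)).gen| = _
    rw [hmk, abs_zero]
    refine le_bot_iff.1 (le_of_forall_prime fun P hP _ => ?_)
    rw [hρ P hP]
    exact hzero P hP

end Representation

theorem theoremT
    (𝕜 : Type u) [DivisionRing 𝕜] [LinearOrder 𝕜] [IsStrictOrderedRing 𝕜] [Countable 𝕜]
    (L : Type v) [DistribLattice L] [OrderBot L]
    (hL : CompletelyNormalLattice L) (hcard : #L ≤ ℵ₁) :
    ∃ (F : Type (max u v)) (_ : AddCommGroup F) (_ : Lattice F) (_ : IsOrderedAddMonoid F)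
      (_ : Module 𝕜 F) (_ : IsOrderedModule 𝕜 F) (f : LatticeHom (Idc 𝕜 F) L),
      f ⊥ = ⊥ ∧ Function.Surjective f := by
  obtain ⟨a, ha, hsingle⟩ := exists_signMap_eq_single (𝕜 := 𝕜) hL hcard
  choose N lin hadd hmod hN using
    fun P : {P : Order.Ideal L // P.IsPrime} => ha.exists_residue P.2
  let E := ∀ P, (L →₀ 𝕜) ⧸ N P
  have : IsOrderedModule 𝕜 E := IsOrderedModule.of_smul_nonneg fun c hc x hx P =>
    smul_nonneg hc (hx P)
  let π : (L →₀ 𝕜) →ₗ[𝕜] E := LinearMap.pi fun P => (N P).mkQ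
  let V : Submodule 𝕜 E := LinearMap.range π
  -- For meets, total order in each coordinate (`g ⊓ h ≤ 0` iff `g ≤ 0` or `h ≤ 0`) matches
  -- primality of `P`.
  have hrep : ∀ g : V.latticeSpan, ∃ e : L, ∀ P, e ∈ P.1 ↔ (g : E) P ≤ 0 := by
    rintro ⟨g, hg⟩
    induction hg using latticeClosure_sup_inf_induction with
    | mem g hg =>
      obtain ⟨x, rfl⟩ := hg
      exact ⟨a x, fun P => (hN P x).symm⟩
    | sup g _ h _ h1 h2 =>
      obtain ⟨x, hx⟩ := h1
      obtain ⟨y, hy⟩ := h2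
      refine ⟨x ⊔ y, fun P => ?_⟩
      rw [Order.Ideal.sup_mem_iff, hx, hy]
      exact sup_le_iff.symm
    | inf g _ h _ h1 h2 =>
      obtain ⟨x, hx⟩ := h1
      obtain ⟨y, hy⟩ := h2
      refine ⟨x ⊓ y, fun P => ?_⟩
      rw [P.2.inf_mem_iff, hx, hy]
      exact inf_le_iff.symm
  choose ρ hρ using hrep
  obtain ⟨f, hbot, hf⟩ := exists_latticeHom_of_support (𝕜 := 𝕜)
    (fun P => {g : V.latticeSpan | ∀ hP : P.IsPrime, (g : E) ⟨P, hP⟩ ≤ 0}) ρ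
    (fun P hP g => (hρ g ⟨P, hP⟩).trans ⟨fun h _ => h, fun h => h hP⟩)
    (fun P hP g h => ⟨fun H => ⟨fun _ => (sup_le_iff.1 (H hP)).1,
        fun _ => (sup_le_iff.1 (H hP)).2⟩,
      fun H _ => sup_le (H.1 hP) (H.2 hP)⟩)
    (fun P hP g h => ⟨fun H => (inf_le_iff.1 (H hP)).imp (fun h _ => h) (fun h _ => h),
      fun H _ => inf_le_iff.2 (H.imp (fun h => h hP) (fun h => h hP))⟩)
    (fun P hP _ => le_rfl)
    (fun P hP c hc g hg _ => smul_nonpos_of_nonneg_of_nonpos hc (hg hP))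
  refine ⟨V.latticeSpan, inferInstance, inferInstance, inferInstance, inferInstance,
    inferInstance, f, hbot, fun e => ?_⟩
  let g : V.latticeSpan := ⟨π (Finsupp.single e 1), subset_latticeClosure ⟨_, rfl⟩⟩
  -- The positive part is needed because `f` sees only `|g|`, which would also record where `g` is
  -- negative.
  refine ⟨Idc.mk 𝕜 (g ⊔ 0), ?_⟩
  rw [hf, abs_of_nonneg le_sup_right]
  have key : ∀ P : Order.Ideal L, P.IsPrime → (ρ (g ⊔ 0) ∈ P ↔ e ∈ P) := by
    intro P hP
    rw [hρ (g ⊔ 0) ⟨P, hP⟩]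
    refine Iff.trans ?_ ((hN ⟨P, hP⟩ (Finsupp.single e 1)).trans (by rw [hsingle]))
    exact sup_le_iff.trans (and_iff_left le_rfl)
  exact le_antisymm (le_of_forall_prime fun P hP => (key P hP).2)
    (le_of_forall_prime fun P hP => (key P hP).1)
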